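/- **Setting.** Let $(\mathcal X,d)$ be a separable metric space with its Borel $\sigma$-algebra, $P$ a probability distribution on $\mathcal X\times\{-1,+1\}$ with marginal $\mu$ on $\mathcal X$, and $\eta(x)=\mathbb E(Y\mid X=x)$ for $(X,Y)\sim P$. Let $B(x,r)=\{z: d(x,z)\le r\}$. The Bayes risk is $R^*=\tfrac12\,\mathbb E_{X\sim\mu}\,[1-|\eta(X)|]$. A classifier is a map $g:\mathcal X\to\{-1,+1,?\}$, and its risk is $R(g)=P\{(x,y): g(x)\ne y\}$, so that the answer "?" always counts as an error. Let $\widetilde R(g)$ be the risk in which the answer "?" at a point $x$ with $\eta(x)=0$, where each label is wrong with probability $\tfrac12$, counts as an error with probability $\tfrac12$ only: $$\widetilde R(g)=R(g)-\tfrac12\,\mu\{x:\eta(x)=0,\ g(x)=\,?\}.$$ **Classifier.** Given $(x_1,y_1),\dots,(x_n,y_n)\in\mathcal X\times\{-1,+1\}$, let $\#_n(S)=|\{i:x_i\in S\}|$ and $\eta_n(S)=\frac1{\#_n(S)}\sum_{i:x_i\in S}y_i$. Let $B_k(x)$ be the smallest closed ball centered at $x$ that contains exactly $k$ training points (values of $k$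 for which there is none are skipped). The AKNN classifier with confidence parameter $\delta$ finds the smallest $0<k\le n$ with $$|\eta_n(B_k(x))|>c_1\sqrt{\frac{\log n+\log(1/\delta)}{k}}$$ and returns $\operatorname{sign}(\eta_n(B_k(x)))$ at $x$; if there is no such $k$ it returns "?". Here $c_1\ge 2$ is any absolute constant. **Theorem (universal consistency).** Suppose that $(\mathcal X,d,\mu)$ satisfies the Lebesgue differentiation condition: for every bounded measurable $f:\mathcal X\to\mathbb R$ and $\mu$-a.e. $x$, $$\lim_{r\downarrow0}\frac1{\mu(B(x,r))}\int_{B(x,r)}f\,d\mu=f(x).$$ Let $(\delta_n)$ be a sequence in $[0,1]$ with $\sum_n\delta_n<\infty$ and $\lim_{n\to\infty}\log(1/\delta_n)/n=0$ (where $\log(1/0)=\infty$). Let $g_n$ be the AKNN classifier with parameter $\delta_n$ built from the first $n$ points of an i.i.d. sequence drawn from $P$. Then, for every $P$ with marginal $\mu$ (that is, for every conditional expectation $\eta$), $\widetilde R(g_n)\to R^*$ almost surely. In particular, if $\mu\{x:\eta(x)=0\}=0$, then $R(g_n)\to R^*$ almost surely. -/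

import Mathlib

open MeasureTheory ProbabilityTheory Filter Topology

noncomputable section

namespace AKNN

/-! Labels are elements of `ℤˣ`, i.e. `1` and `-1`.  A classifier with values in `{-1, +1, ?}` is a
map `X → Option ℤˣ`, where `none` stands for the answer "?". -/

instance instMeasurableSingletonClassLabel : MeasurableSingletonClass ℤˣ where
  measurableSet_singleton a :=
    ⟨{(a : ℤ)}, measurableSet_singleton _, by ext b; simp [Units.ext_iff]⟩

/-- Lebesgue differentiation condition: for every bounded measurable `f : X → ℝ` and `μ`-almost
every `x`, the averages of `f` over the closed balls `B(x, r)` tend to `f x` as `r ↓ 0`. -/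
def LebesgueDifferentiation {X : Type*} [MetricSpace X] [MeasurableSpace X]
    (μ : Measure X) : Prop :=
  ∀ f : X → ℝ, Measurable f → (∃ C : ℝ, ∀ x, |f x| ≤ C) →
    ∀ᵐ x ∂μ, Tendsto
      (fun r : ℝ => (μ.real (Metric.closedBall x r))⁻¹ * ∫ z in Metric.closedBall x r, f z ∂μ)
      (𝓝[>] 0) (𝓝 (f x))

/-- `η` is (a version of) the conditional expectation `η(x) = E(Y | X = x)`, where `(X, Y)` has
law `P`. -/
def IsCondBias {X : Type*} [MeasurableSpace X] (P : Measure (X × ℤˣ)) (η : X → ℝ) : Prop :=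
  Measurable η ∧
    (fun z : X × ℤˣ => η z.1) =ᵐ[P]
      P[(fun z : X × ℤˣ => ((z.2 : ℤ) : ℝ)) |
        MeasurableSpace.comap (Prod.fst : X × ℤˣ → X) inferInstance]

/-- The Bayes risk `R* = (1/2) E_{X ∼ μ} [1 - |η(X)|]`. -/
def bayesRisk {X : Type*} [MeasurableSpace X] (μ : Measure X) (η : X → ℝ) : ℝ :=
  (1 / 2) * ∫ x, (1 - |η x|) ∂μ

/-- The risk `R(g) = P {(x, y) : g x ≠ y}`; the answer "?" is always an error. -/
def risk {X : Type*} [MeasurableSpace X] (P : Measure (X × ℤˣ)) (g : X → Option ℤˣ) : ℝ :=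
  P.real {z | g z.1 ≠ some z.2}

/-- The risk in which the answer "?" at a point with `η x = 0`, where both labels are wrong with
probability `1/2`, counts as an error with probability `1/2`.  Everywhere else "?" is an error. -/
def tieRisk {X : Type*} [MeasurableSpace X] (P : Measure (X × ℤˣ)) (η : X → ℝ)
    (g : X → Option ℤˣ) : ℝ :=
  P.real {z | g z.1 ≠ some z.2 ∧ ¬ (η z.1 = 0 ∧ g z.1 = none)} +
    (1 / 2) * P.real {z | η z.1 = 0 ∧ g z.1 = none}

section Sample

variable {X : Type*} {n : ℕ} (s : Fin n → X × ℤˣ)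

open Classical in
/-- The empirical count `#ₙ(A)`: the number of indices `i` whose point lies in `A`. -/
def empCount (A : Set X) : ℕ := (Finset.univ.filter fun i => (s i).1 ∈ A).card

open Classical in
/-- The empirical bias `ηₙ(A)`: the average label of the training points in `A`. -/
def empBias (A : Set X) : ℝ :=
  (∑ i ∈ Finset.univ.filter (fun i => (s i).1 ∈ A), (((s i).2 : ℤ) : ℝ)) / empCount s A

/-- The confidence width `Δ(n, k, δ) = c₁ √((log n + log (1/δ)) / k)`. -/
def width (c₁ : ℝ) (n k : ℕ) (δ : ℝ) : ℝ :=
  c₁ * Real.sqrt ((Real.log n + Real.log (1 / δ)) / k)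

variable [MetricSpace X] (x : X)

/-- The radii of the closed balls centred at `x` that contain exactly `k` training points. -/
def kRadii (k : ℕ) : Set ℝ := {r | 0 ≤ r ∧ empCount s (Metric.closedBall x r) = k}

/-- `B_k(x)`: the smallest closed ball centred at `x` with exactly `k` training points.  It is
undefined (junk here) when `kRadii s x k` is empty. -/
def kBall (k : ℕ) : Set X := Metric.closedBall x (sInf (kRadii s x k))

/-- `0 < k ≤ n`, the ball `B_k(x)` is defined, and it has a significant bias. -/
def Significant (c₁ δ : ℝ) (k : ℕ) : Prop :=
  0 < k ∧ k ≤ n ∧ (kRadii s x k).Nonempty ∧ width c₁ n k δ < |empBias s (kBall s x k)|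

open Classical in
/-- The adaptive `k`-nearest neighbour classifier with constant `c₁` and confidence parameter `δ`
(for `0 < δ ≤ 1`): the sign of the empirical bias of `B_k(x)`, for the smallest `k` for which
`B_k(x)` has a significant bias, and "?" if there is no such `k`. -/
def classifier (c₁ δ : ℝ) : Option ℤˣ :=
  if h : ∃ k, Significant s x c₁ δ k then
    some (if 0 < empBias s (kBall s x (Nat.find h)) then 1 else -1)
  else none

end Sample

end AKNN

end

/-! Fix a point `x` where `η x` has sign `ε`. By Lebesgue differentiation, for almost every such `x`
there is `r₀ > 0` such that every ball about `x` of radius at most `r₀` has nonnegative true bias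
towards `ε`, strictly positive for `r₀` itself. Two facts then hold almost surely for all large `n`.

No wrong answer: no ball of radius at most `r₀` through a training point has an empirical bias
against `ε` exceeding the confidence width (`measure_exists_deviation_le` and Borel–Cantelli). The
radius is random, but it depends on one training point only. Conditionally on that point the others
are still i.i.d., and a Chernoff bound applies.

Some answer: by the strong law the signed label sum over `B(x, r₀)` grows linearly in `n`, while the
width at `k = n` tends to `0`; hence this ball is significant.

The first significant ball is therefore inside `B(x, r₀)` and votes `ε`
(`classifier_eq_some_of_closedBall`). Fubini exchanges "almost every `x`" and "almost every sample",
and dominated convergence passes to the risks. Points with `η x = 0` need no control, since every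
answer there costs `1/2` in `tieRisk`. -/

namespace AKNN

/-! ### Deterministic combinatorics of nearest-neighbour balls -/

section Sample

variable {X : Type*} {n : ℕ} {s : Fin n → X × ℤˣ}

theorem empCount_mono {A B : Set X} (h : A ⊆ B) : empCount s A ≤ empCount s B := by
  classical
  unfold empCount
  exact Finset.card_le_card fun i hi => by simp_all [h _]

theorem empCount_le (A : Set X) : empCount s A ≤ n := by
  classical
  unfold empCount
  exact (Finset.card_le_univ _).trans (by simp)

theorem empCount_lt_of_mem {A B : Set X} (h : A ⊆ B) {j : Fin n} (hA : (s j).1 ∉ A)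
    (hB : (s j).1 ∈ B) : empCount s A < empCount s B := by
  classical
  unfold empCount
  refine Finset.card_lt_card ⟨fun i hi => ?_, fun hs => ?_⟩
  · simp only [Finset.mem_filter, Finset.mem_univ, true_and] at hi ⊢
    exact h hi
  · exact hA (by simpa using hs (show j ∈ _ by simpa using hB))

theorem empCount_pos_of_mem {A : Set X} {j : Fin n} (h : (s j).1 ∈ A) : 0 < empCount s A := by
  classical
  unfold empCount
  exact Finset.card_pos.2 ⟨j, by simpa using h⟩

theorem empBias_eq_of_empCount_eq {A B : Set X} (h : A ⊆ B)
    (hc : empCount s A = empCount s B) : empBias s A = empBias s B := by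
  have hmem : ∀ i, (s i).1 ∈ A ↔ (s i).1 ∈ B := fun i =>
    ⟨fun hi => h hi, fun hi => by
      by_contra hA
      exact (empCount_lt_of_mem h hA hi).ne hc⟩
  unfold empBias
  rw [hc]
  refine congrArg (· / _) (Finset.sum_congr ?_ fun _ _ => rfl)
  ext i
  simp [hmem]

theorem empCount_mul_empBias (A : Set X) [DecidablePred (· ∈ A)] :
    (empCount s A : ℝ) * empBias s A =
      ∑ i, if (s i).1 ∈ A then (((s i).2 : ℤ) : ℝ) else 0 := by
  classical
  unfold empBias
  rcases Nat.eq_zero_or_pos (empCount s A) with h | h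
  · have h' : ∀ i, (s i).1 ∉ A := fun i hi => (empCount_pos_of_mem hi).ne' h
    simp [h, h']
  · rw [mul_div_cancel₀ _ (by positivity), Finset.sum_filter]
    refine Finset.sum_congr rfl fun i _ => ?_
    split_ifs <;> rfl

theorem empCount_eq_sum (A : Set X) [DecidablePred (· ∈ A)] :
    (empCount s A : ℝ) = ∑ i, if (s i).1 ∈ A then (1 : ℝ) else 0 := by
  classical
  unfold empCount
  rw [Finset.card_filter]
  push_cast
  refine Finset.sum_congr rfl fun i _ => ?_
  split_ifs <;> rfl

variable [MetricSpace X] {x : X}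

/-- Shrinking a ball down to its farthest training point loses no training point, and shrinking
further loses that one. So the infimum defining `kBall` is attained. -/
theorem exists_isLeast_kRadii {k : ℕ} (hk : 0 < k) {r : ℝ} (hr : r ∈ kRadii s x k) :
    ∃ j, dist (s j).1 x ≤ r ∧ IsLeast (kRadii s x k) (dist (s j).1 x) := by
  classical
  obtain ⟨hr0, hrk⟩ := hr
  have hne : (Finset.univ.filter fun i => (s i).1 ∈ Metric.closedBall x r).Nonempty := by
    rw [← Finset.card_pos]
    have : empCount s (Metric.closedBall x r) =
      (Finset.univ.filter fun i => (s i).1 ∈ Metric.closedBall x r).card := by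
        unfold empCount; congr
    omega
  obtain ⟨j, hj, hmax⟩ := Finset.exists_max_image _ (fun i => dist (s i).1 x) hne
  simp only [Finset.mem_filter, Finset.mem_univ, true_and, Metric.mem_closedBall] at hj hmax
  have hcount : empCount s (Metric.closedBall x (dist (s j).1 x)) = k := by
    refine le_antisymm (hrk ▸ empCount_mono (Metric.closedBall_subset_closedBall hj)) ?_
    rw [← hrk]
    unfold empCount
    refine Finset.card_le_card fun i hi => ?_
    simp only [Finset.mem_filter, Finset.mem_univ, true_and, Metric.mem_closedBall] at hi ⊢
    exact hmax i hi
  refine ⟨j, hj, ⟨dist_nonneg, hcount⟩, fun r' hr' => ?_⟩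
  by_contra! hlt
  have := empCount_lt_of_mem (s := s) (j := j)
    (Metric.closedBall_subset_closedBall (x := x) hlt.le) (by simpa using hlt) (by simp)
  rw [hr'.2, hcount] at this
  exact this.false

theorem exists_kBall_eq {k : ℕ} (hk : 0 < k) {r : ℝ} (hr : r ∈ kRadii s x k) :
    ∃ j, dist (s j).1 x ≤ r ∧ kBall s x k = Metric.closedBall x (dist (s j).1 x) ∧
      empCount s (Metric.closedBall x (dist (s j).1 x)) = k := by
  obtain ⟨j, hj, hl⟩ := exists_isLeast_kRadii hk hr
  exact ⟨j, hj, by rw [kBall, hl.csInf_eq], hl.1.2⟩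

theorem empBias_kBall {k : ℕ} (hk : 0 < k) {r : ℝ} (hr : r ∈ kRadii s x k) :
    empBias s (kBall s x k) = empBias s (Metric.closedBall x r) := by
  obtain ⟨j, hj, hB, hc⟩ := exists_kBall_eq hk hr
  rw [hB]
  exact empBias_eq_of_empCount_eq (Metric.closedBall_subset_closedBall hj) (hc.trans hr.2.symm)

/-- Trades the infimum over radii for a quantifier over finitely many training points; measurability
and the union bound both rely on this form. -/
theorem exists_kBall_iff {k : ℕ} (hk : 0 < k) (p : ℝ → Prop) :
    ((kRadii s x k).Nonempty ∧ p (empBias s (kBall s x k))) ↔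
      ∃ j, empCount s (Metric.closedBall x (dist (s j).1 x)) = k ∧
        p (empBias s (Metric.closedBall x (dist (s j).1 x))) := by
  constructor
  · rintro ⟨⟨r, hr⟩, hp⟩
    obtain ⟨j, -, hB, hc⟩ := exists_kBall_eq hk hr
    exact ⟨j, hc, hB ▸ hp⟩
  · rintro ⟨j, hc, hp⟩
    have hr : dist (s j).1 x ∈ kRadii s x k := ⟨dist_nonneg, hc⟩
    exact ⟨⟨_, hr⟩, by rwa [empBias_kBall hk hr]⟩

theorem width_nonneg {c₁ : ℝ} (hc : 0 ≤ c₁) (n k : ℕ) (δ : ℝ) : 0 ≤ width c₁ n k δ :=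
  mul_nonneg hc (Real.sqrt_nonneg _)

/-- Significance of `B(x, r)` forces the search to stop at a ball no larger than it. There the
empirical bias exceeds the width in absolute value, and `hdev` excludes the sign `-ε`. -/
theorem classifier_eq_some_of_closedBall {c₁ δ : ℝ} (hc : 0 ≤ c₁) (ε : ℤˣ) {r : ℝ} (hr : 0 ≤ r)
    (hpos : 0 < empCount s (Metric.closedBall x r))
    (hsig : width c₁ n (empCount s (Metric.closedBall x r)) δ <
      |empBias s (Metric.closedBall x r)|)
    (hdev : ∀ j, dist (s j).1 x ≤ r →
      -width c₁ n (empCount s (Metric.closedBall x (dist (s j).1 x))) δ ≤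
        ((ε : ℤ) : ℝ) * empBias s (Metric.closedBall x (dist (s j).1 x))) :
    classifier s x c₁ δ = some ε := by
  classical
  have hrk : r ∈ kRadii s x (empCount s (Metric.closedBall x r)) := ⟨hr, rfl⟩
  have hS : Significant s x c₁ δ (empCount s (Metric.closedBall x r)) :=
    ⟨hpos, empCount_le _, ⟨r, hrk⟩, by rwa [empBias_kBall hpos hrk]⟩
  have hex : ∃ k, Significant s x c₁ δ k := ⟨_, hS⟩
  unfold classifier
  rw [dif_pos hex]
  congr 1
  obtain ⟨h0, -, ⟨r', hr'⟩, hw⟩ := Nat.find_spec hex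
  have hle := Nat.find_min' hex hS
  obtain ⟨j, hj, hB, hcj⟩ := exists_kBall_eq h0 hr'
  -- A larger radius would give a count above that of `B(x, r)`, against minimality of `Nat.find`.
  have hjr : dist (s j).1 x ≤ r := by
    by_contra! hlt
    have := empCount_lt_of_mem (s := s) (j := j)
      (Metric.closedBall_subset_closedBall (x := x) hlt.le) (by simpa using hlt) (by simp)
    omega
  have hd := hdev j hjr
  rw [hcj, ← hB] at hd
  have hwn := width_nonneg hc n (Nat.find hex) δ
  rcases Int.units_eq_one_or ε with rfl | rfl
  · rw [if_pos]
    by_contra! hneg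
    rw [abs_of_nonpos hneg] at hw
    simp at hd
    linarith
  · rw [if_neg]
    intro hp
    rw [abs_of_pos hp] at hw
    simp at hd
    linarith

theorem classifier_eq_some_iff {c₁ δ : ℝ} {a : ℤˣ} :
    classifier s x c₁ δ = some a ↔
      ∃ k, (∀ m < k, ¬ Significant s x c₁ δ m) ∧ 0 < k ∧ k ≤ n ∧
        ∃ j, empCount s (Metric.closedBall x (dist (s j).1 x)) = k ∧
          (width c₁ n k δ < |empBias s (Metric.closedBall x (dist (s j).1 x))| ∧
            (if 0 < empBias s (Metric.closedBall x (dist (s j).1 x)) then 1 else -1) = a) := by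
  classical
  have key : ∀ k, (0 < k ∧ k ≤ n ∧
        ∃ j, empCount s (Metric.closedBall x (dist (s j).1 x)) = k ∧
          (width c₁ n k δ < |empBias s (Metric.closedBall x (dist (s j).1 x))| ∧
            (if 0 < empBias s (Metric.closedBall x (dist (s j).1 x)) then 1 else -1) = a)) ↔
      Significant s x c₁ δ k ∧ (if 0 < empBias s (kBall s x k) then 1 else -1) = a := by
    intro k
    unfold Significant
    constructor
    · rintro ⟨h1, h2, h3⟩
      have := (exists_kBall_iff h1
        (fun b => width c₁ n k δ < |b| ∧ (if 0 < b then 1 else -1) = a)).2 h3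
      tauto
    · rintro ⟨⟨h1, h2, h3, h4⟩, h5⟩
      exact ⟨h1, h2, (exists_kBall_iff h1
        (fun b => width c₁ n k δ < |b| ∧ (if 0 < b then 1 else -1) = a)).1 ⟨h3, h4, h5⟩⟩
  simp only [key]
  unfold classifier
  constructor
  · intro h
    by_cases hex : ∃ k, Significant s x c₁ δ k
    · rw [dif_pos hex] at h
      exact ⟨Nat.find hex, fun m hm => Nat.find_min hex hm, Nat.find_spec hex, Option.some.inj h⟩
    · rw [dif_neg hex] at h
      cases h
  · rintro ⟨k, hmin, hk, hv⟩
    have hex : ∃ k, Significant s x c₁ δ k := ⟨k, hk⟩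
    have hfind : Nat.find hex = k := (Nat.find_eq_iff hex).2 ⟨hk, hmin⟩
    rw [dif_pos hex, hfind, hv]

end Sample

/-! ### Joint measurability of the classifier in the sample and the query point -/

section Measurability

variable {X : Type*} [MetricSpace X] [SecondCountableTopology X] [MeasurableSpace X]
  [BorelSpace X] {n : ℕ}

theorem measurable_label : Measurable fun y : ℤˣ => ((y : ℤ) : ℝ) := measurable_of_countable _

theorem measurable_empCount_dist (j : Fin n) :
    Measurable fun p : (Fin n → X × ℤˣ) × X =>
      empCount p.1 (Metric.closedBall p.2 (dist (p.1 j).1 p.2)) := by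
  classical
  unfold empCount
  simp only [Finset.card_filter, Metric.mem_closedBall]
  refine Finset.measurable_sum _ fun i _ => ?_
  refine Measurable.ite (measurableSet_le ?_ ?_) measurable_const measurable_const <;> fun_prop

theorem measurable_empBias_dist (j : Fin n) :
    Measurable fun p : (Fin n → X × ℤˣ) × X =>
      empBias p.1 (Metric.closedBall p.2 (dist (p.1 j).1 p.2)) := by
  classical
  unfold empBias
  refine Measurable.div ?_ (measurable_from_top.comp (measurable_empCount_dist j))
  simp only [Finset.sum_filter, Metric.mem_closedBall]
  refine Finset.measurable_sum _ fun i _ => ?_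
  refine Measurable.ite (measurableSet_le ?_ ?_) (measurable_label.comp ?_) measurable_const <;>
    fun_prop

theorem measurableSet_exists_ball (k : ℕ) {T : Set ℝ} (hT : MeasurableSet T) :
    MeasurableSet {p : (Fin n → X × ℤˣ) × X |
      ∃ j, empCount p.1 (Metric.closedBall p.2 (dist (p.1 j).1 p.2)) = k ∧
        empBias p.1 (Metric.closedBall p.2 (dist (p.1 j).1 p.2)) ∈ T} := by
  simp only [Set.ofPred_exists]
  exact MeasurableSet.iUnion fun j =>
    ((measurable_empCount_dist j) (measurableSet_singleton k)).inter
      ((measurable_empBias_dist j) hT)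

theorem measurableSet_significant (c₁ δ : ℝ) (k : ℕ) :
    MeasurableSet {p : (Fin n → X × ℤˣ) × X | Significant p.1 p.2 c₁ δ k} := by
  by_cases hk : 0 < k ∧ k ≤ n
  · have hT : MeasurableSet {b : ℝ | width c₁ n k δ < |b|} :=
      measurableSet_lt measurable_const (by fun_prop)
    convert measurableSet_exists_ball (X := X) (n := n) k hT using 1
    ext p
    simp only [Significant, hk, true_and, Set.mem_ofPred_eq]
    exact exists_kBall_iff (s := p.1) (x := p.2) hk.1 (fun b => width c₁ n k δ < |b|)
  · convert MeasurableSet.empty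
    ext p
    simp only [Significant, Set.mem_ofPred_eq, Set.mem_empty_iff_false, iff_false]
    tauto

theorem measurableSet_classifier_eq (c₁ δ : ℝ) (a : ℤˣ) :
    MeasurableSet {p : (Fin n → X × ℤˣ) × X | classifier p.1 p.2 c₁ δ = some a} := by
  simp only [classifier_eq_some_iff, Set.ofPred_exists, Set.ofPred_and]
  refine MeasurableSet.iUnion fun k => .inter ?_ (.inter (.const _) (.inter (.const _) ?_))
  · simp only [Set.ofPred_forall]
    exact .iInter fun m => .iInter fun _ => (measurableSet_significant c₁ δ m).compl
  · have hT : MeasurableSet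
        {b : ℝ | width c₁ n k δ < |b| ∧ (if 0 < b then (1 : ℤˣ) else -1) = a} := by
      refine (measurableSet_lt measurable_const measurable_id.abs).inter ?_
      exact (Measurable.ite (measurableSet_lt measurable_const measurable_id)
        measurable_const measurable_const) (measurableSet_singleton a)
    convert measurableSet_exists_ball (X := X) (n := n) k hT using 1
    ext p
    simp

end Measurability

/-! ### Exponential moments -/

open scoped ENNReal

/-- Integrating a product of factors that all depend on the `j`-th coordinate, by conditioning on
this coordinate. -/
theorem lintegral_pi_mul_prod_le {E : Type*} [MeasurableSpace E] (P : Measure E)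
    [IsProbabilityMeasure P] {m : ℕ} (j : Fin (m + 1)) {D : E → ℝ≥0∞} {H : E → E → ℝ≥0∞}
    (hD : Measurable D) (hH : Measurable (Function.uncurry H)) {C : ℝ≥0∞} (hDC : ∀ w, D w ≤ C)
    (hH1 : ∀ w, D w ≠ 0 → ∫⁻ z, H w z ∂P ≤ 1) :
    ∫⁻ s, D (s j) * ∏ i, H (s j) (s (j.succAbove i)) ∂(Measure.pi fun _ : Fin (m + 1) => P) ≤
      C := by
  have hmp := measurePreserving_piFinSuccAbove (fun _ : Fin (m + 1) => P) j
  have hHw : ∀ w, Measurable (H w) := fun w => hH.comp measurable_prodMk_left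
  have hmeas : Measurable fun q : E × (Fin m → E) => D q.1 * ∏ i, H q.1 (q.2 i) := by
    refine (hD.comp measurable_fst).mul (Finset.measurable_prod _ fun i _ => ?_)
    exact hH.comp (measurable_fst.prodMk ((measurable_pi_apply i).comp measurable_snd))
  calc ∫⁻ s, D (s j) * ∏ i, H (s j) (s (j.succAbove i)) ∂(Measure.pi fun _ : Fin (m + 1) => P)
      = ∫⁻ q, D q.1 * ∏ i, H q.1 (q.2 i) ∂(P.prod (Measure.pi fun _ : Fin m => P)) := by
        rw [← hmp.map_eq, lintegral_map hmeas hmp.measurable]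
        rfl
    _ = ∫⁻ w, ∫⁻ t, D w * ∏ i, H w (t i) ∂(Measure.pi fun _ : Fin m => P) ∂P :=
        lintegral_prod _ hmeas.aemeasurable
    _ ≤ ∫⁻ _, C ∂P := by
        refine lintegral_mono fun w => ?_
        have hprod : ∫⁻ t, ∏ i, H w (t i) ∂(Measure.pi fun _ : Fin m => P) =
            ∏ _i : Fin m, ∫⁻ z, H w z ∂P := by
          have hind : iIndepFun (fun (i : Fin m) (t : Fin m → E) => H w (t i))
              (Measure.pi fun _ : Fin m => P) :=
            iIndepFun_pi (X := fun _ => H w) fun i => (hHw w).aemeasurable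
          rw [lintegral_prod_eq_prod_lintegral_of_indepFun _ _ hind
            fun i => (hHw w).comp (measurable_pi_apply i)]
          refine Finset.prod_congr rfl fun i _ => ?_
          exact (measurePreserving_eval (fun _ : Fin m => P) i).lintegral_comp (hHw w)
        rw [lintegral_const_mul, hprod]
        -- The moment bound is available only where `D w ≠ 0`; elsewhere the whole integrand
        -- vanishes.
        · by_cases hw : D w = 0
          · simp [hw]
          · calc D w * ∏ _i : Fin m, ∫⁻ z, H w z ∂P ≤ C * 1 :=
                  mul_le_mul' (hDC w) (Finset.prod_le_one' fun _ _ => hH1 w hw)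
              _ = C := mul_one C
        · exact Finset.measurable_prod _ fun i _ => (hHw w).comp (measurable_pi_apply i)
    _ = C := by simp

section

variable {X : Type*} [MeasurableSpace X]

theorem abs_label (ε : ℤˣ) : |((ε : ℤ) : ℝ)| = 1 := by
  rcases Int.units_eq_one_or ε with rfl | rfl <;> simp

theorem integrable_label (P : Measure (X × ℤˣ)) [IsFiniteMeasure P] :
    Integrable (fun z : X × ℤˣ => ((z.2 : ℤ) : ℝ)) P := by
  refine .of_bound ((measurable_label.comp measurable_snd).aestronglyMeasurable) 1 (ae_of_all _ ?_)
  intro z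
  simpa using (abs_label z.2).le

/-- The exponential moment of a label tilted by `t` and truncated to a set on which the label is
biased towards `ε`. -/
theorem lintegral_exp_tilt_le_one (P : Measure (X × ℤˣ)) [IsProbabilityMeasure P] {A : Set X}
    [DecidablePred (· ∈ A)] (hA : MeasurableSet A) (ε : ℤˣ) {t : ℝ} (ht : 0 ≤ t)
    (hpos : 0 ≤ ∫ z in Prod.fst ⁻¹' A, ((ε : ℤ) : ℝ) * ((z.2 : ℤ) : ℝ) ∂P) :
    ∫⁻ z, ENNReal.ofReal (Real.exp (if z.1 ∈ A then
      -t * (((ε : ℤ) : ℝ) * ((z.2 : ℤ) : ℝ)) - t ^ 2 / 2 else 0)) ∂P ≤ 1 := by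
  set c : ℝ := Real.sinh t * Real.exp (-(t ^ 2 / 2)) with hc
  have hc0 : 0 ≤ c := mul_nonneg (Real.sinh_nonneg_iff.2 ht) (Real.exp_nonneg _)
  set f : X × ℤˣ → ℝ := (Prod.fst ⁻¹' A).indicator fun z => ((ε : ℤ) : ℝ) * ((z.2 : ℤ) : ℝ)
    with hf
  have hA' : MeasurableSet (Prod.fst ⁻¹' A : Set (X × ℤˣ)) := measurable_fst hA
  have hfi : Integrable f P := ((integrable_label P).const_mul _).indicator hA'
  -- For a sign `u`, `exp (-t u) = cosh t - u sinh t`, and `cosh t ≤ exp (t² / 2)`. The exponential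
  -- is thus at most `1 - c u`, whose mean is controlled by `hpos`.
  have hle : ∀ z : X × ℤˣ, Real.exp (if z.1 ∈ A then
      -t * (((ε : ℤ) : ℝ) * ((z.2 : ℤ) : ℝ)) - t ^ 2 / 2 else 0) ≤ 1 - c * f z := by
    intro z
    by_cases hz : z.1 ∈ A
    · have hfz : f z = ((ε : ℤ) : ℝ) * ((z.2 : ℤ) : ℝ) := Set.indicator_of_mem (by exact hz) _
      have hcosh : Real.cosh t * Real.exp (-(t ^ 2 / 2)) ≤ 1 := by
        have := mul_le_mul_of_nonneg_right (Real.cosh_le_exp_half_sq t)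
          (Real.exp_nonneg (-(t ^ 2 / 2)))
        rwa [← Real.exp_add, add_neg_cancel, Real.exp_zero] at this
      rw [if_pos hz, hfz, sub_eq_add_neg, Real.exp_add, hc]
      have hs : Real.exp (-t) = Real.cosh t - Real.sinh t := (Real.cosh_sub_sinh t).symm
      have hs' : Real.exp t = Real.cosh t + Real.sinh t := (Real.cosh_add_sinh t).symm
      rcases Int.units_eq_one_or ε with h1 | h1 <;> rcases Int.units_eq_one_or z.2 with h2 | h2 <;>
        simp only [h1, h2, Units.val_one, Units.val_neg, Int.cast_one, Int.cast_neg, mul_one,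
          mul_neg, neg_neg, hs, hs'] <;> linarith
    · have hfz : f z = 0 := Set.indicator_of_notMem (by exact hz) _
      rw [if_neg hz, hfz]
      simp
  calc _ ≤ ∫⁻ z, ENNReal.ofReal (1 - c * f z) ∂P :=
        lintegral_mono fun z => ENNReal.ofReal_le_ofReal (hle z)
    _ = ENNReal.ofReal (∫ z, (1 - c * f z) ∂P) :=
        (ofReal_integral_eq_lintegral_ofReal ((integrable_const _).sub (hfi.const_mul c))
          (ae_of_all _ fun z => (Real.exp_nonneg _).trans (hle z))).symm
    _ ≤ 1 := by
        rw [integral_sub (integrable_const _) (hfi.const_mul c), integral_const_mul, hf,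
          integral_indicator hA']
        refine ENNReal.ofReal_le_one.2 ?_
        simpa using mul_nonneg hc0 hpos

end

/-! ### Uniform deviation bound for balls through training points -/

section Deviation

variable {X : Type*} [MetricSpace X] [SecondCountableTopology X] [MeasurableSpace X]
  [BorelSpace X]

/-- Chernoff bound conditional on the `j`-th point, which fixes the ball. Fixing `k` as well allows
a deterministic tilt, equal to the width. The `j`-th label is not averaged out and costs the factor
`exp (1 / 2)`. -/
theorem measure_deviation_le (P : Measure (X × ℤˣ)) [IsProbabilityMeasure P] {n : ℕ} (j : Fin n)
    (x : X) {r₀ : ℝ} (ε : ℤˣ)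
    (hpos : ∀ r, 0 ≤ r → r ≤ r₀ →
      0 ≤ ∫ z in Prod.fst ⁻¹' Metric.closedBall x r, ((ε : ℤ) : ℝ) * ((z.2 : ℤ) : ℝ) ∂P)
    {c₁ δ : ℝ} (hc₁ : 2 ≤ c₁) (hδ : 0 < δ) (hδ1 : δ ≤ 1) {k : ℕ} (hk : 0 < k) :
    (Measure.pi fun _ : Fin n => P)
      {s | dist (s j).1 x ≤ r₀ ∧ empCount s (Metric.closedBall x (dist (s j).1 x)) = k ∧
        ((ε : ℤ) : ℝ) * empBias s (Metric.closedBall x (dist (s j).1 x)) < -width c₁ n k δ} ≤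
      ENNReal.ofReal (Real.exp (1 / 2) * (δ / n) ^ 2) := by
  classical
  obtain ⟨m, rfl⟩ : ∃ m, n = m + 1 := ⟨n - 1, by have := j.pos; omega⟩
  set L : ℝ := Real.log (m + 1 : ℕ) + Real.log (1 / δ) with hL
  have hn : (0 : ℝ) < (m + 1 : ℕ) := by positivity
  have hL0 : 0 ≤ L := add_nonneg (Real.log_natCast_nonneg _)
    (Real.log_nonneg ((one_le_div hδ).2 hδ1))
  have hexpL : Real.exp (-(2 * L)) = (δ / (m + 1 : ℕ)) ^ 2 := by
    rw [hL, ← Real.log_mul hn.ne' (by positivity), show ∀ a : ℝ, -(2 * a) = -a + -a by intro a; ring,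
      Real.exp_add, ← Real.log_inv, Real.exp_log (by positivity)]
    field_simp
  have hk' : (0 : ℝ) < k := by exact_mod_cast hk
  set t : ℝ := c₁ * Real.sqrt (L / k) with ht
  have ht0 : 0 ≤ t := by positivity
  have htsq : t ^ 2 * k = c₁ ^ 2 * L := by
    rw [ht, mul_pow, Real.sq_sqrt (by positivity)]
    field_simp
  set H : X × ℤˣ → X × ℤˣ → ℝ≥0∞ := fun w z => ENNReal.ofReal (Real.exp
    (if z.1 ∈ Metric.closedBall x (dist w.1 x) then
      -t * (((ε : ℤ) : ℝ) * ((z.2 : ℤ) : ℝ)) - t ^ 2 / 2 else 0)) with hH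
  -- The factor of the `j`-th point itself, cut off at `r₀` because the bias hypothesis holds only
  -- up to there.
  set D : X × ℤˣ → ℝ≥0∞ := fun w => if dist w.1 x ≤ r₀ then H w w else 0 with hD
  have hHm : Measurable (Function.uncurry H) := by
    simp only [hH, Function.uncurry_def, Metric.mem_closedBall]
    refine ENNReal.measurable_ofReal.comp (Real.measurable_exp.comp (Measurable.ite
      (measurableSet_le (by fun_prop) (by fun_prop)) ?_ measurable_const))
    have : Measurable fun q : (X × ℤˣ) × (X × ℤˣ) => ((q.2.2 : ℤ) : ℝ) :=
      measurable_label.comp (measurable_snd.comp measurable_snd)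
    exact ((this.const_mul _).const_mul _).sub_const _
  have hDm : Measurable D := Measurable.ite (measurableSet_le (by fun_prop) measurable_const)
    (hHm.comp (measurable_id.prodMk measurable_id)) measurable_const
  have hDC : ∀ w, D w ≤ ENNReal.ofReal (Real.exp (1 / 2)) := by
    intro w
    simp only [hD]
    split_ifs
    · simp only [hH]
      refine ENNReal.ofReal_le_ofReal (Real.exp_le_exp.2 ?_)
      rw [if_pos (by simp)]
      have h1 : |((ε : ℤ) : ℝ) * ((w.2 : ℤ) : ℝ)| = 1 := by rw [abs_mul, abs_label, abs_label, one_mul]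
      -- The exponent is at most `t - t² / 2`, whose maximum is `1 / 2`, at `t = 1`.
      nlinarith [neg_abs_le (((ε : ℤ) : ℝ) * ((w.2 : ℤ) : ℝ)), sq_nonneg (t - 1)]
    · exact zero_le
  have hH1 : ∀ w, D w ≠ 0 → ∫⁻ z, H w z ∂P ≤ 1 := by
    intro w hw
    have hwr : dist w.1 x ≤ r₀ := by
      by_contra hlt
      exact hw (if_neg hlt)
    exact lintegral_exp_tilt_le_one P Metric.isClosed_closedBall.measurableSet ε ht0
      (hpos _ dist_nonneg hwr)
  set F : (Fin (m + 1) → X × ℤˣ) → ℝ≥0∞ := fun s => D (s j) * ∏ i, H (s j) (s (j.succAbove i))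
    with hF
  have hFm : Measurable F := by
    refine (hDm.comp (measurable_pi_apply j)).mul (Finset.measurable_prod _ fun i _ => ?_)
    have hpair : Measurable fun s : Fin (m + 1) → X × ℤˣ => (s j, s (j.succAbove i)) :=
      (measurable_pi_apply j).prodMk (measurable_pi_apply _)
    exact hHm.comp hpair
  have hFC := lintegral_pi_mul_prod_le P j hDm hHm hDC hH1
  have hsub : {s : Fin (m + 1) → X × ℤˣ | dist (s j).1 x ≤ r₀ ∧
      empCount s (Metric.closedBall x (dist (s j).1 x)) = k ∧
      ((ε : ℤ) : ℝ) * empBias s (Metric.closedBall x (dist (s j).1 x)) <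
        -width c₁ (m + 1) k δ} ⊆ {s | ENNReal.ofReal (Real.exp (2 * L)) ≤ F s} := by
    rintro s ⟨hs1, hs2, hs3⟩
    have hFs : F s = ENNReal.ofReal (Real.exp (-t * (((ε : ℤ) : ℝ) *
        (k * empBias s (Metric.closedBall x (dist (s j).1 x)))) - t ^ 2 / 2 * k)) := by
      have h1 : F s = ∏ i, H (s j) (s i) := by
        rw [Fin.prod_univ_succAbove _ j]
        simp only [hF, hD, if_pos hs1]
      rw [h1, ← ENNReal.ofReal_prod_of_nonneg fun i _ => Real.exp_nonneg _, ← Real.exp_sum, ← hs2,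
        empCount_mul_empBias, empCount_eq_sum, Finset.mul_sum, Finset.mul_sum, Finset.mul_sum,
        ← Finset.sum_sub_distrib]
      congr 3
      ext i
      split_ifs <;> ring
    change _ ≤ F s
    rw [hFs]
    refine ENNReal.ofReal_le_ofReal (Real.exp_le_exp.2 ?_)
    have hw : width c₁ (m + 1) k δ = t := rfl
    rw [hw] at hs3
    have h2 : t ^ 2 * k ≤ -t * (((ε : ℤ) : ℝ) *
        (k * empBias s (Metric.closedBall x (dist (s j).1 x)))) := by
      have := mul_le_mul_of_nonneg_left hs3.le (mul_nonneg ht0 hk'.le)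
      linarith
    -- The exponent is at least `t² k / 2 = c₁² L / 2`; `c₁ ≥ 2` makes it at least `2 L`, so
    -- Markov's inequality yields `(δ / n)²`.
    have h3 : 4 * L ≤ c₁ ^ 2 * L := mul_le_mul_of_nonneg_right (by nlinarith) hL0
    linarith
  refine (measure_mono hsub).trans ?_
  have hmarkov := (mul_meas_ge_le_lintegral (μ := Measure.pi fun _ : Fin (m + 1) => P) hFm
    (ENNReal.ofReal (Real.exp (2 * L)))).trans hFC
  calc (Measure.pi fun _ : Fin (m + 1) => P) {s | ENNReal.ofReal (Real.exp (2 * L)) ≤ F s}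
      = ENNReal.ofReal (Real.exp (-(2 * L))) * (ENNReal.ofReal (Real.exp (2 * L)) *
          (Measure.pi fun _ : Fin (m + 1) => P)
            {s | ENNReal.ofReal (Real.exp (2 * L)) ≤ F s}) := by
        rw [← mul_assoc, ← ENNReal.ofReal_mul (Real.exp_nonneg _), ← Real.exp_add]
        simp
    _ ≤ ENNReal.ofReal (Real.exp (-(2 * L))) * ENNReal.ofReal (Real.exp (1 / 2)) := by gcongr
    _ = ENNReal.ofReal (Real.exp (1 / 2) * (δ / (m + 1 : ℕ)) ^ 2) := by
        rw [← ENNReal.ofReal_mul (Real.exp_nonneg _), hexpL, mul_comm]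

/-- Union bound over the `n²` pairs of a training point and a count, which the factor `(δ / n)²`
absorbs. -/
theorem measure_exists_deviation_le (P : Measure (X × ℤˣ)) [IsProbabilityMeasure P] (n : ℕ)
    (x : X) {r₀ : ℝ} (ε : ℤˣ)
    (hpos : ∀ r, 0 ≤ r → r ≤ r₀ →
      0 ≤ ∫ z in Prod.fst ⁻¹' Metric.closedBall x r, ((ε : ℤ) : ℝ) * ((z.2 : ℤ) : ℝ) ∂P)
    {c₁ δ : ℝ} (hc₁ : 2 ≤ c₁) (hδ : 0 < δ) (hδ1 : δ ≤ 1) :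
    (Measure.pi fun _ : Fin n => P)
      {s | ∃ j, dist (s j).1 x ≤ r₀ ∧
        ((ε : ℤ) : ℝ) * empBias s (Metric.closedBall x (dist (s j).1 x)) <
          -width c₁ n (empCount s (Metric.closedBall x (dist (s j).1 x))) δ} ≤
      ENNReal.ofReal (Real.exp (1 / 2) * δ ^ 2) := by
  have hsub : {s : Fin n → X × ℤˣ | ∃ j, dist (s j).1 x ≤ r₀ ∧
        ((ε : ℤ) : ℝ) * empBias s (Metric.closedBall x (dist (s j).1 x)) <
          -width c₁ n (empCount s (Metric.closedBall x (dist (s j).1 x))) δ} ⊆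
      ⋃ q : Fin n × Fin n, {s | dist (s q.1).1 x ≤ r₀ ∧
        empCount s (Metric.closedBall x (dist (s q.1).1 x)) = q.2 + 1 ∧
        ((ε : ℤ) : ℝ) * empBias s (Metric.closedBall x (dist (s q.1).1 x)) <
          -width c₁ n (q.2 + 1) δ} := by
    rintro s ⟨j, h1, h2⟩
    have hpos' : 0 < empCount s (Metric.closedBall x (dist (s j).1 x)) :=
      empCount_pos_of_mem (j := j) (by simp)
    have hle := empCount_le (s := s) (Metric.closedBall x (dist (s j).1 x))
    have heq : empCount s (Metric.closedBall x (dist (s j).1 x)) =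
      empCount s (Metric.closedBall x (dist (s j).1 x)) - 1 + 1 := by omega
    refine Set.mem_iUnion.2 ⟨(j, ⟨empCount s (Metric.closedBall x (dist (s j).1 x)) - 1,
      by omega⟩), h1, heq, ?_⟩
    change _ < -width c₁ n (empCount s (Metric.closedBall x (dist (s j).1 x)) - 1 + 1) δ
    rwa [← heq]
  refine (measure_mono hsub).trans ((measure_iUnion_fintype_le _ _).trans ?_)
  refine (Finset.sum_le_sum fun q _ =>
    measure_deviation_le P q.1 x ε hpos hc₁ hδ hδ1 (Nat.succ_pos _)).trans ?_
  rw [Finset.sum_const, nsmul_eq_mul, ← ENNReal.ofReal_natCast, ← ENNReal.ofReal_mul (by positivity)]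
  refine ENNReal.ofReal_le_ofReal ?_
  rcases Nat.eq_zero_or_pos n with rfl | hn
  · simp
    positivity
  · simp only [Finset.card_univ, Fintype.card_prod, Fintype.card_fin, Nat.cast_mul]
    refine le_of_eq ?_
    field_simp

end Deviation

/-! ### Conditional bias and the risk as an integral over `X` -/

section Bias

variable {X : Type*} [MeasurableSpace X] {P : Measure (X × ℤˣ)} {η : X → ℝ}

theorem risk_eq_tieRisk (h0 : P.fst {x | η x = 0} = 0) (hη : Measurable η) (g : X → Option ℤˣ) :
    risk P g = tieRisk P η g := by
  have hnull : P {z | η z.1 = 0} = 0 := by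
    rwa [Measure.fst_apply (s := {x | η x = 0}) (hη (measurableSet_singleton 0))] at h0
  have h1 : P.real {z | η z.1 = 0 ∧ g z.1 = none} = 0 := by
    rw [measureReal_def, measure_mono_null (fun z hz => hz.1) hnull, ENNReal.toReal_zero]
  rw [tieRisk, h1, mul_zero, add_zero, risk]
  refine measureReal_congr ?_
  have hae : ∀ᵐ z ∂P, ¬ η z.1 = 0 := by simpa [ae_iff] using hnull
  refine eventuallyEq_set.2 ?_
  filter_upwards [hae] with z hz
  tauto

theorem IsCondBias.ae_abs_le_one (hη : IsCondBias P η) : ∀ᵐ x ∂P.fst, |η x| ≤ 1 := by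
  have hbd : ∀ᵐ z ∂P, |((z.2 : ℤ) : ℝ)| ≤ 1 := ae_of_all _ fun z => (abs_label z.2).le
  have h := ae_bdd_abs_condExp_of_ae_bdd_abs (R := (1 : ℝ))
    (m := MeasurableSpace.comap (Prod.fst : X × ℤˣ → X) inferInstance) hbd
  rw [Measure.fst, ae_map_iff measurable_fst.aemeasurable
    (measurableSet_le hη.1.abs measurable_const)]
  filter_upwards [h, hη.2] with z h1 h2
  rw [h2]
  exact h1

variable [IsProbabilityMeasure P]

theorem IsCondBias.integrable (hη : IsCondBias P η) : Integrable η P.fst :=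
  .of_bound hη.1.aestronglyMeasurable 1 hη.ae_abs_le_one

theorem IsCondBias.integral_mul_label (hη : IsCondBias P η) {f : X → ℝ} (hf : Measurable f)
    {C : ℝ} (hC : ∀ x, |f x| ≤ C) :
    ∫ z, f z.1 * ((z.2 : ℤ) : ℝ) ∂P = ∫ x, f x * η x ∂P.fst := by
  set m : MeasurableSpace (X × ℤˣ) := MeasurableSpace.comap Prod.fst inferInstance with hm
  have hle : m ≤ Prod.instMeasurableSpace := measurable_fst.comap_le
  have hfm : StronglyMeasurable[m] fun z : X × ℤˣ => f z.1 :=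
    (hf.comp (comap_measurable Prod.fst)).stronglyMeasurable
  have hpull := condExp_stronglyMeasurable_mul_of_bound hle hfm (integrable_label P) C
    (ae_of_all _ fun z => hC z.1)
  have hmul : Measurable fun x => f x * η x := hf.mul hη.1
  calc ∫ z, f z.1 * ((z.2 : ℤ) : ℝ) ∂P
      = ∫ z, (P[(fun z : X × ℤˣ => f z.1) * (fun z : X × ℤˣ => ((z.2 : ℤ) : ℝ)) | m]) z ∂P :=
        (integral_condExp hle).symm
    _ = ∫ z, f z.1 * η z.1 ∂P := by
        refine integral_congr_ae ?_
        filter_upwards [hpull, hη.2] with z h1 h2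
        rw [h1, Pi.mul_apply, h2]
    _ = ∫ x, f x * η x ∂P.fst := by
        rw [Measure.fst, integral_map measurable_fst.aemeasurable hmul.aestronglyMeasurable]

theorem IsCondBias.setIntegral_label (hη : IsCondBias P η) {A : Set X} (hA : MeasurableSet A)
    (ε : ℤˣ) :
    ∫ z in Prod.fst ⁻¹' A, ((ε : ℤ) : ℝ) * ((z.2 : ℤ) : ℝ) ∂P =
      ((ε : ℤ) : ℝ) * ∫ x in A, η x ∂P.fst := by
  have h := hη.integral_mul_label (f := A.indicator 1) (measurable_one.indicator hA) (C := 1)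
    (fun x => by by_cases hx : x ∈ A <;> simp [hx])
  rw [integral_const_mul, ← integral_indicator (measurable_fst hA), ← integral_indicator hA]
  congr 1
  refine Eq.trans (integral_congr_ae (ae_of_all _ fun z => ?_))
    (h.trans (integral_congr_ae (ae_of_all _ fun x => ?_)))
  · by_cases hz : z.1 ∈ A <;> simp [Set.indicator, hz]
  · by_cases hx : x ∈ A <;> simp [hx]

/-- The numerical value of an answer, with `0` for "?". -/
def vote (o : Option ℤˣ) : ℝ := o.elim 0 fun a => ((a : ℤ) : ℝ)

theorem abs_vote_le (o : Option ℤˣ) : |vote o| ≤ 1 := by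
  cases o with
  | none => simp [vote]
  | some a => exact (abs_label a).le

theorem measurable_vote {g : X → Option ℤˣ} (hg : ∀ a : ℤˣ, MeasurableSet {x | g x = some a}) :
    Measurable fun x => vote (g x) := by
  classical
  have : (fun x => vote (g x)) = fun x =>
      if g x = some 1 then (1 : ℝ) else if g x = some (-1) then -1 else 0 := by
    ext x
    rcases h : g x with - | a
    · simp [vote]
    · rcases Int.units_eq_one_or a with rfl | rfl <;> simp [vote]
  rw [this]
  exact Measurable.ite (hg 1) measurable_const
    (Measurable.ite (hg (-1)) measurable_const measurable_const)

theorem measurableSet_eq_none {g : X → Option ℤˣ}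
    (hg : ∀ a : ℤˣ, MeasurableSet {x | g x = some a}) : MeasurableSet {x | g x = none} := by
  have : {x | g x = none} = (⋃ a : ℤˣ, {x | g x = some a})ᶜ := by
    ext x
    rcases h : g x <;> simp [h]
  rw [this]
  exact (MeasurableSet.iUnion hg).compl

theorem tieRisk_eq_integral (hη : IsCondBias P η) {g : X → Option ℤˣ}
    (hg : ∀ a : ℤˣ, MeasurableSet {x | g x = some a}) :
    tieRisk P η g = ∫ x, (1 / 2 * (1 - vote (g x) * η x) +
      1 / 2 * {x | η x ≠ 0 ∧ g x = none}.indicator 1 x) ∂P.fst := by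
  classical
  have hnone := measurableSet_eq_none hg
  have hη0 : MeasurableSet {x | η x = 0} := hη.1 (measurableSet_singleton 0)
  set C : Set X := {x | η x ≠ 0 ∧ g x = none} with hC
  have hCm : MeasurableSet C := hη0.compl.inter hnone
  have hind : Measurable (C.indicator (1 : X → ℝ)) := measurable_one.indicator hCm
  set B : Set (X × ℤˣ) := {z | η z.1 = 0 ∧ g z.1 = none} with hB
  have hBm : MeasurableSet B := measurable_fst (hη0.inter hnone)
  set A : Set (X × ℤˣ) := {z | g z.1 ≠ some z.2 ∧ ¬ (η z.1 = 0 ∧ g z.1 = none)} with hA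
  have hAm : MeasurableSet A := by
    have : A = (⋃ a : ℤˣ, Prod.fst ⁻¹' {x | g x = some a} ∩ Prod.snd ⁻¹' {a})ᶜ ∩ Bᶜ := by
      ext z
      simp only [hA, hB, Set.mem_inter_iff, Set.mem_compl_iff, Set.mem_iUnion, Set.mem_preimage,
        Set.mem_singleton_iff, Set.mem_ofPred_eq]
      refine and_congr_left fun _ => not_congr ⟨fun h => ⟨_, h, rfl⟩, ?_⟩
      rintro ⟨a, h1, h2⟩
      rw [h1, h2]
    rw [this]
    exact (MeasurableSet.iUnion fun a => (measurable_fst (hg a)).inter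
      (measurable_snd (measurableSet_singleton a))).compl.inter hBm.compl
  -- With vote `0`, the answer "?" costs `1/2` in the linear term; the indicator of `C` adds the
  -- other half where `η` is nonzero.
  have hpt : ∀ z : X × ℤˣ, A.indicator (1 : X × ℤˣ → ℝ) z + 1 / 2 * B.indicator 1 z =
      1 / 2 * (1 - vote (g z.1) * ((z.2 : ℤ) : ℝ)) + 1 / 2 * C.indicator 1 z.1 := by
    rintro ⟨x, y⟩
    simp only [Set.indicator, hA, hB, hC, Set.mem_ofPred_eq, Pi.one_apply]
    rcases h : g x with - | a
    · by_cases hx : η x = 0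
      · simp [hx, vote]
      · simp [hx, vote]; norm_num
    · rcases Int.units_eq_one_or a with rfl | rfl <;> rcases Int.units_eq_one_or y with rfl | rfl <;>
        simp [vote, Units.ext_iff] <;> norm_num
  have hi1 : Integrable (A.indicator (1 : X × ℤˣ → ℝ)) P := (integrable_const 1).indicator hAm
  have hi2 : Integrable (B.indicator (1 : X × ℤˣ → ℝ)) P := (integrable_const 1).indicator hBm
  have hi3 : Integrable (C.indicator (1 : X → ℝ)) P.fst := (integrable_const 1).indicator hCm
  have hi3' : Integrable (fun z : X × ℤˣ => C.indicator (1 : X → ℝ) z.1) P :=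
    hi3.comp_measurable measurable_fst
  have hv := measurable_vote hg
  have hi4 : Integrable (fun z : X × ℤˣ => vote (g z.1) * ((z.2 : ℤ) : ℝ)) P :=
    (integrable_label P).bdd_mul (hv.comp measurable_fst).aestronglyMeasurable
      (ae_of_all _ fun z => abs_vote_le _)
  have hi5 : Integrable (fun x => vote (g x) * η x) P.fst :=
    hη.integrable.bdd_mul hv.aestronglyMeasurable (ae_of_all _ fun z => abs_vote_le _)
  have h3 : ∫ z : X × ℤˣ, C.indicator (1 : X → ℝ) z.1 ∂P = ∫ x, C.indicator (1 : X → ℝ) x ∂P.fst := by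
    rw [Measure.fst, integral_map measurable_fst.aemeasurable hind.aestronglyMeasurable]
  have e1 : Integrable (fun z : X × ℤˣ => 1 / 2 * (1 - vote (g z.1) * ((z.2 : ℤ) : ℝ))) P :=
    ((integrable_const _).sub hi4).const_mul _
  have e2 : Integrable (fun x => 1 / 2 * (1 - vote (g x) * η x)) P.fst :=
    ((integrable_const _).sub hi5).const_mul _
  calc tieRisk P η g
      = ∫ z, (A.indicator (1 : X × ℤˣ → ℝ) z + 1 / 2 * B.indicator 1 z) ∂P := by
        rw [integral_add hi1 (hi2.const_mul _), integral_const_mul, integral_indicator_one hAm,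
          integral_indicator_one hBm, tieRisk]
    _ = ∫ z, (1 / 2 * (1 - vote (g z.1) * ((z.2 : ℤ) : ℝ)) + 1 / 2 * C.indicator 1 z.1) ∂P := by
        simp only [hpt]
    _ = _ := by
        rw [integral_add e1 (hi3'.const_mul _), integral_add e2 (hi3.const_mul _),
          integral_const_mul, integral_const_mul, integral_const_mul, integral_const_mul,
          integral_sub (integrable_const _) hi4, integral_sub (integrable_const _) hi5,
          hη.integral_mul_label hv fun _ => abs_vote_le _, h3]
        simp

/-- Where `η` vanishes the integrand is `1/2` for every answer, so nothing is asked of `g n` there.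
Elsewhere it eventually equals the Bayes integrand. -/
theorem tendsto_tieRisk (hη : IsCondBias P η) {g : ℕ → X → Option ℤˣ}
    (hg : ∀ n, ∀ a : ℤˣ, MeasurableSet {x | g n x = some a})
    (hlim : ∀ᵐ x ∂P.fst, (0 < η x → ∀ᶠ n in atTop, g n x = some 1) ∧
      (η x < 0 → ∀ᶠ n in atTop, g n x = some (-1))) :
    Tendsto (fun n => tieRisk P η (g n)) atTop (𝓝 (bayesRisk P.fst η)) := by
  simp only [fun n => tieRisk_eq_integral hη (hg n), bayesRisk, ← integral_const_mul]
  -- Almost everywhere the linear term is at most `1` and the "?" term at most `1/2`.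
  refine tendsto_integral_of_dominated_convergence (fun _ => 3 / 2) (fun n => ?_)
    (integrable_const _) (fun n => ?_) ?_
  · have h1 := measurable_vote (hg n)
    have h2 : MeasurableSet {x | η x ≠ 0 ∧ g n x = none} :=
      (hη.1 (measurableSet_singleton 0)).compl.inter (measurableSet_eq_none (hg n))
    have h3 : Measurable ({x | η x ≠ 0 ∧ g n x = none}.indicator (1 : X → ℝ)) :=
      measurable_one.indicator h2
    exact (((measurable_const.sub (h1.mul hη.1)).const_mul _).add
      (h3.const_mul _)).aestronglyMeasurable
  · filter_upwards [hη.ae_abs_le_one] with x hx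
    have h1 : |vote (g n x) * η x| ≤ 1 := by
      rw [abs_mul]
      exact mul_le_one₀ (abs_vote_le _) (abs_nonneg _) hx
    have h2 := abs_le.1 h1
    have h3 : 0 ≤ {x | η x ≠ 0 ∧ g n x = none}.indicator (1 : X → ℝ) x :=
      Set.indicator_nonneg (fun _ _ => zero_le_one) _
    have h4 : {x | η x ≠ 0 ∧ g n x = none}.indicator (1 : X → ℝ) x ≤ 1 :=
      Set.indicator_le' (fun _ _ => le_rfl) (fun _ _ => zero_le_one) _
    rw [Real.norm_eq_abs, abs_le]
    constructor <;> linarith [h2.1, h2.2]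
  · filter_upwards [hlim] with x hx
    refine tendsto_const_nhds.congr' ?_
    rcases lt_trichotomy (η x) 0 with h | h | h
    · filter_upwards [hx.2 h] with n hn
      simp [hn, vote, Set.indicator, abs_of_neg h]
    · simp [h, Set.indicator]
    · filter_upwards [hx.1 h] with n hn
      simp [hn, vote, Set.indicator, abs_of_pos h]

end Bias

/-! ### Almost sure convergence of the answer at a fixed point -/

section Pointwise

variable {X : Type*} [MetricSpace X] [MeasurableSpace X] [BorelSpace X]
  {P : Measure (X × ℤˣ)} [IsProbabilityMeasure P] {η : X → ℝ}

/-- At almost every point where `η` has the sign `ε`, all small balls are biased towards `ε`. -/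
theorem LebesgueDifferentiation.ae_exists_biased_balls (hP : LebesgueDifferentiation P.fst)
    (hη : IsCondBias P η) :
    ∀ᵐ x ∂P.fst, ∀ ε : ℤˣ, 0 < ((ε : ℤ) : ℝ) * η x → ∃ r₀ > 0,
      (∀ r, 0 ≤ r → r ≤ r₀ →
        0 ≤ ∫ z in Prod.fst ⁻¹' Metric.closedBall x r, ((ε : ℤ) : ℝ) * ((z.2 : ℤ) : ℝ) ∂P) ∧
      0 < ∫ z in Prod.fst ⁻¹' Metric.closedBall x r₀, ((ε : ℤ) : ℝ) * ((z.2 : ℤ) : ℝ) ∂P := by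
  -- `η` is bounded by `1` only almost everywhere, whereas the differentiation condition requires a
  -- bound at every point.
  set η' : X → ℝ := fun x => max (-1) (min 1 (η x)) with hη'
  have hm : Measurable η' := measurable_const.max (measurable_const.min hη.1)
  have heq : η' =ᵐ[P.fst] η := by
    filter_upwards [hη.ae_abs_le_one] with x hx
    rw [hη']
    simp only
    rw [min_eq_right (abs_le.1 hx).2, max_eq_right (abs_le.1 hx).1]
  have hbd : ∀ x, |η' x| ≤ 1 := fun x =>
    abs_le.2 ⟨le_max_left _ _, max_le (by norm_num) (min_le_left _ _)⟩
  filter_upwards [hP η' hm ⟨1, hbd⟩, heq] with x hx hxeq ε hε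
  have hint : ∀ r, ∫ z in Prod.fst ⁻¹' Metric.closedBall x r,
      ((ε : ℤ) : ℝ) * ((z.2 : ℤ) : ℝ) ∂P =
        ((ε : ℤ) : ℝ) * ∫ z in Metric.closedBall x r, η' z ∂P.fst := by
    intro r
    rw [hη.setIntegral_label Metric.isClosed_closedBall.measurableSet]
    congr 1
    exact integral_congr_ae (ae_restrict_of_ae (heq.mono fun _ h => h.symm))
  have hev := (hx.const_mul ((ε : ℤ) : ℝ)).eventually (lt_mem_nhds (hxeq ▸ hε))
  obtain ⟨u, hu, hsub⟩ := mem_nhdsGT_iff_exists_Ioc_subset.1 hev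
  have hpos : ∀ r, 0 < r → r ≤ u →
      0 < ((ε : ℤ) : ℝ) * ∫ z in Metric.closedBall x r, η' z ∂P.fst := by
    intro r hr hru
    have h : 0 < ((ε : ℤ) : ℝ) * ((P.fst.real (Metric.closedBall x r))⁻¹ *
      ∫ z in Metric.closedBall x r, η' z ∂P.fst) := hsub ⟨hr, hru⟩
    rw [mul_left_comm] at h
    exact pos_of_mul_pos_right h (by positivity)
  refine ⟨u, hu, fun r hr hru => ?_, by rw [hint]; exact hpos u hu le_rfl⟩
  rw [hint]
  -- Radius `0` matters when `x` is an atom: the ball is `{x}` and the sign is that of `η x` itself.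
  rcases hr.eq_or_lt with rfl | hr
  · rw [Metric.closedBall_zero, integral_singleton, smul_eq_mul, hxeq, mul_left_comm]
    exact mul_nonneg measureReal_nonneg hε.le
  · exact (hpos r hr hru).le

variable [SecondCountableTopology X]

/-- Borel–Cantelli excludes significant bias against `ε` within `r₀`; the strong law makes the ball
of radius `r₀` significant. -/
theorem ae_eventually_classifier_eq
    {c₁ : ℝ} (hc₁ : 2 ≤ c₁) {δ : ℕ → ℝ} (hδ : ∀ n, δ n ∈ Set.Icc (0 : ℝ) 1)
    (hδ_sum : Summable δ) (hδ_pos : ∀ᶠ n in atTop, 0 < δ n)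
    (hδ_log : Tendsto (fun n : ℕ => Real.log (1 / δ n) / n) atTop (𝓝 0))
    {Ω : Type*} [MeasurableSpace Ω] {Q : Measure Ω} [IsProbabilityMeasure Q]
    {Z : ℕ → Ω → X × ℤˣ} (hZ_meas : ∀ i, Measurable (Z i))
    (hZ_law : ∀ i, Q.map (Z i) = P) (hZ_indep : iIndepFun Z Q)
    {x : X} (ε : ℤˣ) {r₀ : ℝ} (hr₀ : 0 < r₀)
    (hpos : ∀ r, 0 ≤ r → r ≤ r₀ →
      0 ≤ ∫ z in Prod.fst ⁻¹' Metric.closedBall x r, ((ε : ℤ) : ℝ) * ((z.2 : ℤ) : ℝ) ∂P)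
    (hlt : 0 < ∫ z in Prod.fst ⁻¹' Metric.closedBall x r₀, ((ε : ℤ) : ℝ) * ((z.2 : ℤ) : ℝ) ∂P) :
    ∀ᵐ ω ∂Q, ∀ᶠ n in atTop,
      classifier (fun i : Fin n => Z i ω) x c₁ (δ n) = some ε := by
  classical
  set S : ∀ n : ℕ, Set (Fin n → X × ℤˣ) := fun n => {s | ∃ j, dist (s j).1 x ≤ r₀ ∧
        ((ε : ℤ) : ℝ) * empBias s (Metric.closedBall x (dist (s j).1 x)) <
          -width c₁ n (empCount s (Metric.closedBall x (dist (s j).1 x))) (δ n)} with hS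
  have hdev : ∀ᵐ ω ∂Q, ∀ᶠ n in atTop, (fun i : Fin n => Z i ω) ∉ S n := by
    -- The deviation bound needs `0 < δ n`; indices where this fails contribute the empty set and
    -- are finitely many.
    set T : ℕ → Set Ω := fun n => {ω | 0 < δ n ∧ (fun i : Fin n => Z i ω) ∈ S n} with hT
    have hTle : ∀ n, Q (T n) ≤ ENNReal.ofReal (Real.exp (1 / 2) * δ n) := by
      intro n
      by_cases h0 : 0 < δ n
      · have hmap : Q.map (fun ω (i : Fin n) => Z i ω) = Measure.pi fun _ : Fin n => P := by
          have h := (hZ_indep.precomp (g := fun i : Fin n => (i : ℕ)) Fin.val_injective)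
          rw [(iIndepFun_iff_map_fun_eq_pi_map
            fun i : Fin n => (hZ_meas i).aemeasurable).1 h]
          simp only [hZ_law]
        have hmZ : AEMeasurable (fun ω (i : Fin n) => Z i ω) Q :=
          (measurable_pi_lambda _ fun i : Fin n => hZ_meas i).aemeasurable
        calc Q (T n) ≤ Q ((fun ω (i : Fin n) => Z i ω) ⁻¹' S n) :=
              measure_mono fun ω hω => hω.2
          _ ≤ Q.map (fun ω (i : Fin n) => Z i ω) (S n) := Measure.le_map_apply hmZ _
          _ ≤ ENNReal.ofReal (Real.exp (1 / 2) * δ n ^ 2) := by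
              rw [hmap]
              exact measure_exists_deviation_le P n x ε hpos hc₁ h0 (hδ n).2
          _ ≤ _ := by
              refine ENNReal.ofReal_le_ofReal (mul_le_mul_of_nonneg_left ?_ (Real.exp_nonneg _))
              nlinarith [(hδ n).1, (hδ n).2]
      · have : T n = ∅ := Set.eq_empty_of_forall_notMem fun ω hω => h0 hω.1
        simp [this]
    have hsum : ∑' n, Q (T n) ≠ ∞ := by
      refine ne_top_of_le_ne_top ?_ (ENNReal.tsum_le_tsum hTle)
      exact (hδ_sum.mul_left _).tsum_ofReal_ne_top
    filter_upwards [ae_eventually_notMem hsum] with ω hω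
    filter_upwards [hω, hδ_pos] with n h1 h2 h3
    exact h1 ⟨h2, h3⟩
  set A : Set X := Metric.closedBall x r₀ with hA
  have hAm : MeasurableSet (Prod.fst ⁻¹' A : Set (X × ℤˣ)) :=
    measurable_fst Metric.isClosed_closedBall.measurableSet
  set W : X × ℤˣ → ℝ :=
    (Prod.fst ⁻¹' A).indicator fun z => ((ε : ℤ) : ℝ) * ((z.2 : ℤ) : ℝ) with hW
  have hWm : Measurable W :=
    ((measurable_label.comp measurable_snd).const_mul _).indicator hAm
  have hWi : Integrable W P := ((integrable_label P).const_mul _).indicator hAm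
  set c := ∫ z in Prod.fst ⁻¹' A, ((ε : ℤ) : ℝ) * ((z.2 : ℤ) : ℝ) ∂P with hc
  have hslln : ∀ᵐ ω ∂Q, Tendsto (fun n : ℕ => (∑ i ∈ Finset.range n, W (Z i ω)) / n)
      atTop (𝓝 c) := by
    have hmean : ∫ ω, W (Z 0 ω) ∂Q = c := by
      rw [hc, ← integral_indicator hAm, ← hZ_law 0,
        integral_map (hZ_meas 0).aemeasurable hWm.aestronglyMeasurable]
    rw [← hmean]
    refine strong_law_ae_real (fun i ω => W (Z i ω)) ?_ ?_ ?_
    · have : Integrable W (Q.map (Z 0)) := by rwa [hZ_law 0]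
      exact this.comp_measurable (hZ_meas 0)
    · intro i j hij
      exact (hZ_indep.indepFun hij).comp hWm hWm
    · intro i
      exact IdentDistrib.comp ⟨(hZ_meas i).aemeasurable, (hZ_meas 0).aemeasurable,
        (hZ_law i).trans (hZ_law 0).symm⟩ hWm
  have hwidth : Tendsto (fun n : ℕ =>
      c₁ * Real.sqrt ((Real.log n + Real.log (1 / δ n)) / n)) atTop (𝓝 0) := by
    have hlog : Tendsto (fun n : ℕ => Real.log n / n) atTop (𝓝 0) :=
      Real.isLittleO_log_id_atTop.tendsto_div_nhds_zero.comp tendsto_natCast_atTop_atTop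
    have h := ((hlog.add hδ_log).sqrt).const_mul c₁
    simp only [add_zero, Real.sqrt_zero, mul_zero] at h
    simpa only [add_div] using h
  filter_upwards [hdev, hslln] with ω h1 h2
  filter_upwards [h1, h2.eventually (lt_mem_nhds (half_lt_self hlt)),
    hwidth.eventually (gt_mem_nhds (half_pos hlt)), eventually_gt_atTop 0] with n hn1 hn2 hn3 hn4
  set s : Fin n → X × ℤˣ := fun i => Z i ω with hs
  have hn : (0 : ℝ) < n := by exact_mod_cast hn4
  have hsumW : ((ε : ℤ) : ℝ) * (empCount s A * empBias s A) = ∑ i ∈ Finset.range n, W (Z i ω) := by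
    rw [empCount_mul_empBias, Finset.mul_sum, Finset.sum_range]
    refine Finset.sum_congr rfl fun i _ => ?_
    simp only [hW, Set.indicator, Set.mem_preimage, mul_ite, mul_zero, hs]
  rw [← hsumW, lt_div_iff₀ hn] at hn2
  have habs : ((ε : ℤ) : ℝ) * (empCount s A * empBias s A) ≤ empCount s A * |empBias s A| := by
    refine (le_abs_self _).trans ?_
    rw [abs_mul, abs_label, one_mul, abs_mul, Nat.abs_cast]
  have hN : 0 < empCount s A := by
    by_contra! h0
    have : empCount s A = 0 := by omega
    rw [this] at habs hn2
    simp only [Nat.cast_zero, zero_mul, mul_zero] at hn2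
    have := mul_pos (half_pos hlt) hn
    linarith
  have hN' : (0 : ℝ) < empCount s A := by exact_mod_cast hN
  have hL0 : 0 ≤ Real.log n + Real.log (1 / δ n) := by
    refine add_nonneg (Real.log_natCast_nonneg _) ?_
    rw [one_div, Real.log_inv]
    have := Real.log_nonpos (hδ n).1 (hδ n).2
    linarith
  refine classifier_eq_some_of_closedBall (by linarith) ε hr₀.le hN ?_ ?_
  · change c₁ * Real.sqrt ((Real.log n + Real.log (1 / δ n)) / empCount s A) < |empBias s A|
    set L := Real.log n + Real.log (1 / δ n) with hL
    refine lt_of_mul_lt_mul_left ?_ hN'.le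
    -- Count times width grows with the count, because `a √(L / a) = √(L a)`. The random count can
    -- thus be replaced by `n`.
    have h3 : (empCount s A : ℝ) * Real.sqrt (L / empCount s A) ≤ n * Real.sqrt (L / n) := by
      have hle : (empCount s A : ℝ) ≤ n := by exact_mod_cast empCount_le A
      have key : ∀ a : ℝ, 0 < a → a * Real.sqrt (L / a) = Real.sqrt (L * a) := by
        intro a ha
        rw [← Real.sqrt_sq ha.le, ← Real.sqrt_mul (sq_nonneg a), Real.sqrt_sq ha.le]
        congr 1
        field_simp
      rw [key _ hN', key _ hn]
      exact Real.sqrt_le_sqrt (mul_le_mul_of_nonneg_left hle hL0)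
    have h4 := mul_le_mul_of_nonneg_left h3 (show 0 ≤ c₁ by linarith)
    have h5 := mul_lt_mul_of_pos_right hn3 hn
    linarith
  · intro j hj
    by_contra! hcon
    exact hn1 ⟨j, hj, hcon⟩

end Pointwise

end AKNN

/-! ### Universal consistency -/

theorem theorem3 {X : Type*} [MetricSpace X] [TopologicalSpace.SeparableSpace X]
    [MeasurableSpace X] [BorelSpace X]
    (μ : Measure X) [IsProbabilityMeasure μ]
    (hμ : AKNN.LebesgueDifferentiation μ)
    -- the absolute constant in the width of the confidence interval
    (c₁ : ℝ) (hc₁ : 2 ≤ c₁)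
    -- the confidence parameters; `log (1 / 0) = ∞`, so (2) makes them eventually positive
    (δ : ℕ → ℝ) (hδ : ∀ n, δ n ∈ Set.Icc (0 : ℝ) 1)
    (hδ_sum : Summable δ)
    (hδ_pos : ∀ᶠ n in atTop, 0 < δ n)
    (hδ_log : Tendsto (fun n : ℕ => Real.log (1 / δ n) / n) atTop (𝓝 0))
    -- the distribution of the data, with marginal `μ` and conditional expectation `η`
    (P : Measure (X × ℤˣ)) [IsProbabilityMeasure P] (hP : P.fst = μ)
    (η : X → ℝ) (hη : AKNN.IsCondBias P η)
    -- an infinite i.i.d. training sequence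
    {Ω : Type*} [MeasurableSpace Ω] (Q : Measure Ω) [IsProbabilityMeasure Q]
    (Z : ℕ → Ω → X × ℤˣ) (hZ_meas : ∀ i, Measurable (Z i))
    (hZ_law : ∀ i, Q.map (Z i) = P) (hZ_indep : iIndepFun Z Q) :
    (∀ᵐ ω ∂Q, Tendsto
      (fun n : ℕ => AKNN.tieRisk P η
        (fun x => AKNN.classifier (fun i : Fin n => Z i ω) x c₁ (δ n)))
      atTop (𝓝 (AKNN.bayesRisk μ η))) ∧
    (μ {x | η x = 0} = 0 →
      ∀ᵐ ω ∂Q, Tendsto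
        (fun n : ℕ => AKNN.risk P
          (fun x => AKNN.classifier (fun i : Fin n => Z i ω) x c₁ (δ n)))
        atTop (𝓝 (AKNN.bayesRisk μ η))) := by
  subst hP
  have : SecondCountableTopology X := UniformSpace.secondCountable_of_separable X
  have hC : ∀ n (a : ℤˣ), MeasurableSet {p : X × Ω |
      AKNN.classifier (fun i : Fin n => Z i p.2) p.1 c₁ (δ n) = some a} := by
    intro n a
    have hmap : Measurable fun p : X × Ω => ((fun i : Fin n => Z i p.2), p.1) :=
      (measurable_pi_lambda _ fun i : Fin n => (hZ_meas i).comp measurable_snd).prodMk measurable_fst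
    exact hmap (AKNN.measurableSet_classifier_eq c₁ (δ n) a)
  have hE : ∀ a : ℤˣ, MeasurableSet {p : X × Ω | ∀ᶠ n in atTop,
      AKNN.classifier (fun i : Fin n => Z i p.2) p.1 c₁ (δ n) = some a} := by
    intro a
    simp only [eventually_atTop, Set.ofPred_exists, Set.ofPred_forall]
    exact .iUnion fun N => .iInter fun n => .iInter fun _ => hC n a
  have hlim : ∀ᵐ ω ∂Q, ∀ᵐ x ∂P.fst,
      (0 < η x → ∀ᶠ n in atTop,
        AKNN.classifier (fun i : Fin n => Z i ω) x c₁ (δ n) = some 1) ∧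
      (η x < 0 → ∀ᶠ n in atTop,
        AKNN.classifier (fun i : Fin n => Z i ω) x c₁ (δ n) = some (-1)) := by
    -- The pointwise result has an exceptional null set of samples depending on `x`; Fubini, using
    -- joint measurability, gives one null set of samples good for almost every `x`.
    refine (Measure.ae_ae_comm ?_).1 ?_
    · have hη1 : Measurable fun p : X × Ω => η p.1 := hη.1.comp measurable_fst
      exact ((measurableSet_lt measurable_const hη1).imp (hE 1)).inter
        ((measurableSet_lt hη1 measurable_const).imp (hE (-1)))
    · filter_upwards [hμ.ae_exists_biased_balls hη] with x hx
      refine Filter.Eventually.and ?_ ?_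
      · by_cases h : 0 < η x
        · obtain ⟨r₀, hr₀, h1, h2⟩ := hx 1 (by simpa using h)
          filter_upwards [AKNN.ae_eventually_classifier_eq hc₁ hδ hδ_sum hδ_pos hδ_log hZ_meas
            hZ_law hZ_indep 1 hr₀ h1 h2] with ω hω _ using hω
        · exact ae_of_all _ fun ω h' => absurd h' h
      · by_cases h : η x < 0
        · obtain ⟨r₀, hr₀, h1, h2⟩ := hx (-1) (by simpa using h)
          filter_upwards [AKNN.ae_eventually_classifier_eq hc₁ hδ hδ_sum hδ_pos hδ_log hZ_meas
            hZ_law hZ_indep (-1) hr₀ h1 h2] with ω hω _ using hω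
        · exact ae_of_all _ fun ω h' => absurd h' h
  have htie : ∀ᵐ ω ∂Q, Tendsto
      (fun n : ℕ => AKNN.tieRisk P η
        (fun x => AKNN.classifier (fun i : Fin n => Z i ω) x c₁ (δ n)))
      atTop (𝓝 (AKNN.bayesRisk P.fst η)) := by
    filter_upwards [hlim] with ω hω
    exact AKNN.tendsto_tieRisk hη (fun n a => measurable_prodMk_right (hC n a)) hω
  refine ⟨htie, fun h0 => ?_⟩
  filter_upwards [htie] with ω hω
  simpa only [AKNN.risk_eq_tieRisk h0 hη.1] using hω
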